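/- **Notation.** Let $B_N$ be the braid group on $N$ strands with standard generators $\sigma_1,\dots,\sigma_{N-1}$, and let $\Gamma$ be a group. The Hurwitz action is the right action of $B_N$ on $\Gamma^N$ given by $$(f_1,\dots,f_N)\sigma_i=(f_1,\dots,f_{i-1},f_{i+1},f_{i+1}^{-1}f_if_{i+1},f_{i+2},\dots,f_N).$$ Two vectors are Hurwitz equivalent, written $\cong_H$, if they lie in the same orbit. A vector is a $1$-factorization of $\Gamma$ if the ordered product of its entries is $1$. An element $A\in\Gamma$ has a root if $A=w^k$ for some $w\in\Gamma$ and some integer $k\neq\pm1$. $F_r$ is the free group of rank $r$, and $x^y=y^{-1}xy$. **Construction.** Let $G=\langle z_1,\dots,z_n\mid R_1,\dots,R_m\rangle$ be a finite presentation with $n\ge 2$ in which at least one relator is non-trivial in the free group $F_n$ on $z_1,\dots,z_n$. Fix injective homomorphisms $i_{(r,s)}:F_r\oplus F_s\to F_2\oplus F_2$ for all $r,s\in\mathbb N$, and for each such presentation fix an element $H\in F_n$ that has no root and lies in the normal closure of $R_1,\dots,R_m$. Let $X_1,\dots,X_{n+1}$ be free generators of $F_{n+1}$. For $c\in F_n$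 let $FTL_{s1}(G,c)$ be the image under $i_{(n,n+1)}$, entry by entry, of the following vector of length $m+n+4$ in $F_n\oplus F_{n+1}$: $$\bigl((R_1,1),\dots,(R_m,1),((R_1\cdots R_m)^{-1},1),(z_1,X_1),\dots,(z_n,X_n),((z_1\cdots z_n)^{-1},(X_1\cdots X_n)^{-1}),(c^{-1},X_{n+1}^{-1}),(c,X_{n+1})\bigr).$$ For a word $a$ in the letters $z_i^{\pm1}$ put $FTL_B(G,a)=FTL_{s1}(G,H^a)$. **Theorem.** The choices required in the construction exist. For every such choice and every such presentation $G$: 1. For every word $a$, $FTL_B(G,a)$ is a $1$-factorization of $F_2\oplus F_2$. 2. For all words $a,b$: $a=b$ in $G$ if and only if $FTL_B(G,a)\cong_H FTL_B(G,b)$. 3. For fixed $G$, the map $a\mapsto FTL_B(G,a)$ is computable: some computable function sends each word $a$ to a list of pairs of words in the generators of $F_2$ and their inverses that represent, in order, the entries of $FTL_B(G,a)$. Consequently, the word problem of $G$ reduces to the Hurwitz equivalence problem in $F_2\oplus F_2$. -/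

import Mathlib

/-! ### Braid groups, factorizations and the Hurwitz braid action -/

/-- The relators of the braid group on `n` strands, with generators `σ i` for `i : Fin (n - 1)`. -/
inductive BraidRel (n : ℕ) : FreeGroup (Fin (n - 1)) → Prop
  | braid (i j : Fin (n - 1)) (h : (i : ℕ) + 1 = j) :
      BraidRel n ((FreeGroup.of i * FreeGroup.of j * FreeGroup.of i) *
        (FreeGroup.of j * FreeGroup.of i * FreeGroup.of j)⁻¹)
  | comm (i j : Fin (n - 1)) (h : (i : ℕ) + 2 ≤ j) :
      BraidRel n ((FreeGroup.of i * FreeGroup.of j) * (FreeGroup.of j * FreeGroup.of i)⁻¹)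

/-- The Artin braid group on `n` strands. -/
abbrev BraidGroup (n : ℕ) : Type := PresentedGroup {r | BraidRel n r}

/-- The standard generator `σ i` (indices start from `0`). -/
def braidGen {n : ℕ} (i : Fin (n - 1)) : BraidGroup n := PresentedGroup.of i

/-- The left of the two positions on which `σ i` acts. -/
def posL {n : ℕ} (i : Fin (n - 1)) : Fin n := ⟨i, by omega⟩

/-- The right of the two positions on which `σ i` acts. -/
def posR {n : ℕ} (i : Fin (n - 1)) : Fin n := ⟨i + 1, by omega⟩

theorem posR_ne_posL {n : ℕ} (i : Fin (n - 1)) : posR i ≠ posL i := by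
  simp [posR, posL]

/-- A vector in `G ^ n` is a `g`-factorization if the ordered product of its entries is `g`. -/
def IsFactorization {G : Type*} [Group G] {n : ℕ} (g : G) (F : Fin n → G) : Prop :=
  (List.ofFn F).prod = g

/-- The effect of `σ i`: `(…, x, y, …) ↦ (…, y, y⁻¹ x y, …)`. -/
def hurwitzMove {G : Type*} [Group G] {n : ℕ} (i : Fin (n - 1)) (F : Fin n → G) : Fin n → G :=
  fun k => if k = posL i then F (posR i)
    else if k = posR i then (F (posR i))⁻¹ * F (posL i) * F (posR i) else F k

/-- The effect of `(σ i)⁻¹`: `(…, x, y, …) ↦ (…, x y x⁻¹, x, …)`. -/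
def hurwitzMoveInv {G : Type*} [Group G] {n : ℕ} (i : Fin (n - 1)) (F : Fin n → G) : Fin n → G :=
  fun k => if k = posL i then F (posL i) * F (posR i) * (F (posL i))⁻¹
    else if k = posR i then F (posL i) else F k

/-- The effect of `σ i` as a permutation of the set of all vectors of length `n`. -/
def hurwitzPerm (G : Type*) [Group G] {n : ℕ} (i : Fin (n - 1)) : Equiv.Perm (Fin n → G) where
  toFun := hurwitzMove i
  invFun := hurwitzMoveInv i
  left_inv F := by
    funext k
    have h := posR_ne_posL i
    by_cases h1 : k = posL i
    · subst h1; simp [hurwitzMove, hurwitzMoveInv, h, mul_assoc]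
    · by_cases h2 : k = posR i
      · subst h2; simp [hurwitzMove, hurwitzMoveInv, h]
      · simp [hurwitzMove, hurwitzMoveInv, h1, h2]
  right_inv F := by
    funext k
    have h := posR_ne_posL i
    by_cases h1 : k = posL i
    · subst h1; simp [hurwitzMove, hurwitzMoveInv, h]
    · by_cases h2 : k = posR i
      · subst h2; simp [hurwitzMove, hurwitzMoveInv, h, mul_assoc]
      · simp [hurwitzMove, hurwitzMoveInv, h1, h2]

theorem hurwitzMove_braid {G : Type*} [Group G] {n : ℕ} (i j : Fin (n - 1))
    (h : (i : ℕ) + 1 = j) (F : Fin n → G) :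
    hurwitzMove i (hurwitzMove j (hurwitzMove i F)) =
      hurwitzMove j (hurwitzMove i (hurwitzMove j F)) := by
  have e : posL j = posR i := by simp [posL, posR, h]
  have h1 : posR i ≠ posL i := posR_ne_posL i
  have h2 : posR j ≠ posR i := by simp [posR, Fin.ext_iff]; omega
  have h3 : posR j ≠ posL i := by simp [posR, posL, Fin.ext_iff]; omega
  funext k
  by_cases k1 : k = posL i
  · subst k1; simp [hurwitzMove, e, h1.symm, h2, h3, h3.symm]
  by_cases k2 : k = posR i
  · subst k2; simp [hurwitzMove, e, h1, h1.symm, h2, h3, h3.symm]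
  by_cases k3 : k = posR j
  · subst k3; simp [hurwitzMove, e, h1, h2, h3, h1.symm, h3.symm, mul_assoc]
  · simp [hurwitzMove, e, k1, k2, k3]

theorem hurwitzMove_comm {G : Type*} [Group G] {n : ℕ} (i j : Fin (n - 1))
    (h : (i : ℕ) + 2 ≤ j) (F : Fin n → G) :
    hurwitzMove j (hurwitzMove i F) = hurwitzMove i (hurwitzMove j F) := by
  have h1 : posL j ≠ posL i := by simp [posL, Fin.ext_iff]; omega
  have h2 : posL j ≠ posR i := by simp [posL, posR, Fin.ext_iff]; omega
  have h3 : posR j ≠ posL i := by simp [posL, posR, Fin.ext_iff]; omega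
  have h4 : posR j ≠ posR i := by simp [posR, Fin.ext_iff]; omega
  have hi : posR i ≠ posL i := posR_ne_posL i
  have hj : posR j ≠ posL j := posR_ne_posL j
  funext k
  by_cases k1 : k = posL i
  · subst k1; simp [hurwitzMove, h1.symm, h2.symm, h3.symm, h4.symm]
  by_cases k2 : k = posR i
  · subst k2; simp [hurwitzMove, h1.symm, h2.symm, h3.symm, h4.symm]
  by_cases k3 : k = posL j
  · subst k3; simp [hurwitzMove, h1, h2, h3, h4]
  by_cases k4 : k = posR j
  · subst k4; simp [hurwitzMove, h1, h2, h3, h4]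
  · simp [hurwitzMove, k1, k2, k3, k4]

/-- The Hurwitz braid action as a homomorphism. The opposite group expresses that the action is
a right action. -/
def hurwitzHom (G : Type*) [Group G] (n : ℕ) :
    BraidGroup n →* (Equiv.Perm (Fin n → G))ᵐᵒᵖ :=
  PresentedGroup.toGroup (f := fun i => MulOpposite.op (hurwitzPerm G i)) (by
    rintro r (⟨i, j, h⟩ | ⟨i, j, h⟩)
    · simp only [map_mul, map_inv, FreeGroup.lift_apply_of]
      rw [mul_inv_eq_one]
      apply MulOpposite.unop_injective
      ext1 F
      exact hurwitzMove_braid i j h F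
    · simp only [map_mul, map_inv, FreeGroup.lift_apply_of]
      rw [mul_inv_eq_one]
      apply MulOpposite.unop_injective
      ext1 F
      exact hurwitzMove_comm i j h F)

/-- The right Hurwitz braid action of the braid `b` on the vector `F`. -/
def hurwitzAct {G : Type*} [Group G] {n : ℕ} (F : Fin n → G) (b : BraidGroup n) : Fin n → G :=
  (hurwitzHom G n b).unop F

theorem hurwitzAct_mul {G : Type*} [Group G] {n : ℕ} (F : Fin n → G) (b c : BraidGroup n) :
    hurwitzAct F (b * c) = hurwitzAct (hurwitzAct F b) c := by
  simp [hurwitzAct]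

theorem hurwitzAct_one {G : Type*} [Group G] {n : ℕ} (F : Fin n → G) :
    hurwitzAct F 1 = F := by
  simp [hurwitzAct]

theorem hurwitzAct_braidGen {G : Type*} [Group G] {n : ℕ} (F : Fin n → G) (i : Fin (n - 1)) :
    hurwitzAct F (braidGen i) = hurwitzMove i F := by
  simp [hurwitzAct, hurwitzHom, braidGen, hurwitzPerm]

/-- Two factorizations of length `n` are Hurwitz equivalent if they lie in one orbit of the
Hurwitz action of the braid group on `n` strands. -/
def HurwitzEquiv {G : Type*} [Group G] {n : ℕ} (F K : Fin n → G) : Prop :=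
  ∃ b : BraidGroup n, hurwitzAct F b = K

/-! ### Finite presentations and words -/

/-- Words in `n` symbols and their formal inverses; `(i, true)` is the `i`-th symbol and
`(i, false)` its inverse. Words need not be reduced. -/
abbrev SymWord (n : ℕ) : Type := List (Fin n × Bool)

/-- A finite group presentation `⟨W_1, …, W_n ∣ R_1, …, R_m⟩`. -/
structure FinPresentation where
  /-- the number of generators -/
  n : ℕ
  /-- the number of relators -/
  m : ℕ
  /-- the relators -/
  rel : Fin m → SymWord n

namespace FinPresentation

/-- The relators as elements of the free group on the generators. -/
def relator (P : FinPresentation) (j : Fin P.m) : FreeGroup (Fin P.n) := FreeGroup.mk (P.rel j)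

/-- The group defined by the presentation. -/
abbrev Grp (P : FinPresentation) : Type := PresentedGroup (Set.range P.relator)

/-- The element of the group that a word represents. -/
def eval (P : FinPresentation) (a : SymWord P.n) : P.Grp :=
  PresentedGroup.mk (Set.range P.relator) (FreeGroup.mk a)

/-- The presentation has at least two generators and a nontrivial relation: some relator is
not trivial in the free group. -/
def InGS (P : FinPresentation) : Prop := 2 ≤ P.n ∧ ∃ j, P.relator j ≠ 1

end FinPresentation

/-! ### The construction of the factorizations -/

/-- The factorization
`((R_1,1), …, (R_k,1), (W_1,X_1), …, (W_l,X_l), (H⁻¹,X_{l+1}), (H,X_{l+2}))` of `G₁ × G₂`. -/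
def pFactorization {G₁ G₂ : Type*} [Group G₁] [Group G₂] {k l : ℕ} (X : Fin (l + 2) → G₂)
    (R : Fin k → G₁) (W : Fin l → G₁) (H : G₁) : Fin (k + (l + 2)) → G₁ × G₂ :=
  Fin.append (fun i => (R i, 1))
    (Fin.append (fun j => (W j, X (Fin.castAdd 2 j)))
      ![(H⁻¹, X (Fin.natAdd l 0)), (H, X (Fin.natAdd l 1))])

/-- `(v_1, …, v_k) ↦ (v_1, …, v_k, (v_1 ⋯ v_k)⁻¹)`. -/
def closeUp {G : Type*} [Group G] {k : ℕ} (v : Fin k → G) : Fin (k + 1) → G :=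
  Fin.snoc (α := fun _ => G) v ((List.ofFn v).prod)⁻¹

/-- The vector `(X_1, …, X_n, (X_1 ⋯ X_n)⁻¹, X_{n+1}⁻¹, X_{n+1})` in the free group on
`X_1, …, X_{n+1}`. -/
def xVector (n : ℕ) : Fin (n + 1 + 2) → FreeGroup (Fin (n + 1)) :=
  Fin.append (closeUp fun i : Fin n => FreeGroup.of i.castSucc)
    ![(FreeGroup.of (Fin.last n))⁻¹, FreeGroup.of (Fin.last n)]

/-- An element of a group has a root if it is a `k`-th power for some integer `k ≠ 1, -1`. -/
def HasRoot {G : Type*} [Group G] (A : G) : Prop :=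
  ∃ (w : G) (k : ℤ), k ≠ 1 ∧ k ≠ -1 ∧ A = w ^ k

/-- The group `F₂ ⊕ F₂`. -/
abbrev F2F2 : Type := FreeGroup (Fin 2) × FreeGroup (Fin 2)

/-- The arbitrary choices that are fixed once and for all in the construction: embeddings
`F_r ⊕ F_s → F₂ ⊕ F₂`, and, for each presentation with at least two generators and a nontrivial
relation, an element without roots in the normal closure of the relators. -/
structure FTLChoice where
  /-- the embeddings -/
  emb : ∀ r s : ℕ, FreeGroup (Fin r) × FreeGroup (Fin s) →* F2F2
  emb_injective : ∀ r s, Function.Injective (emb r s)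
  /-- the elements without roots -/
  H : ∀ P : FinPresentation, P.InGS → FreeGroup (Fin P.n)
  H_mem : ∀ P hP, H P hP ∈ Subgroup.normalClosure (Set.range P.relator)
  H_noRoot : ∀ P hP, ¬ HasRoot (H P hP)

namespace FTLChoice

/-- The length of the factorizations attached to a presentation. -/
abbrev len (P : FinPresentation) : ℕ := P.m + 1 + (P.n + 1 + 2)

/-- The factorization `i_{(n,n+1)} P_X(Vf, W, a)` attached to `F_n`, to the relators
`V = (v_1, …, v_m)` and to `a ∈ F_n`, where `Vf = (v_1, …, v_m, (v_1 ⋯ v_m)⁻¹)` and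
`W = (z_1, …, z_n, (z_1 ⋯ z_n)⁻¹)`. -/
def ftlS1 (C : FTLChoice) (P : FinPresentation) (a : FreeGroup (Fin P.n)) : Fin (len P) → F2F2 :=
  fun k => C.emb P.n (P.n + 1)
    (pFactorization (xVector P.n) (closeUp P.relator) (closeUp FreeGroup.of) a k)

/-- The factorization attached to a word `a`: the previous construction at `a⁻¹ H a`. -/
def ftlB (C : FTLChoice) (P : FinPresentation) (hP : P.InGS) (a : SymWord P.n) :
    Fin (len P) → F2F2 :=
  C.ftlS1 P ((FreeGroup.mk a)⁻¹ * C.H P hP * FreeGroup.mk a)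

end FTLChoice

/-- The element of `F₂ ⊕ F₂` represented by a pair of words. -/
def evalPair (p : SymWord 2 × SymWord 2) : F2F2 := (FreeGroup.mk p.1, FreeGroup.mk p.2)

/-!
The proof compares the factorizations for `c = a⁻¹ H a` and `c' = b⁻¹ H b` directly, where `N` is the
normal closure of the relators.

*Equal elements give equivalent factorizations.* The factorization consists of three blocks with
product `1`: the relators `(R_j, 1)`, the generators `(z_i, X_i)`, and `(c⁻¹, X_{n+1}⁻¹)`,
`(c, X_{n+1})`. By Hurwitz moves a block with product `1` can pass every entry `g`, and it can pass it
either unchanged or conjugated by `g`; so it can be conjugated by everything the other entries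
generate (`listHurwitz_conj_append`). Conjugating the relator block by an element over `w ∈ F_n`, then
the last block by an entry `(w⁻¹ R_j w, 1)`, and restoring the relator block, conjugates `c` by
`w⁻¹ R_j w` (`listHurwitz_conj_append_append`). Hence `c` can be conjugated by all of `N`, and
`a⁻¹ b ∈ N` takes `a⁻¹ H a` to `b⁻¹ H b`.

*Equivalent factorizations come from equal elements.* Every entry that arises by Hurwitz moves is a
conjugate of an original entry by an element of the subgroup the entries generate. As `c ∈ N`, this
subgroup lies over the graph of the homomorphism `X_i ↦ z_i`, `X_{n+1} ↦ 1` from `F_{n+1}` to the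
presented group. The exponent sum of `X_{n+1}` shows that `(c', X_{n+1})` is a conjugate
`(u, v)⁻¹ (c, X_{n+1}) (u, v)` of `(c, X_{n+1})`. Then `v` centralizes `X_{n+1}`, so it is a power of
`X_{n+1}`, and `u ∈ N` (`exists_conj_of_hurwitzEquiv`). Now `a u b⁻¹` centralizes `H`, which has no
root, so it is a power of `H` and lies in `N`; therefore `a = b` in the presented group.

*The choices exist.* `F_r` embeds in `F_2` through the conjugates `x ^ i y x ^ (-i)`
(`freeGroup_lift_conj_injective`). An element of `N` without roots is found among the words
`y ^ s T y ^ (-s) T` with `T = ℓ R ℓ⁻¹ ∈ N` reduced: these are cyclically reduced, so that a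
`k`-th power among them has all its letter counts divisible by `k`, and `s` is chosen such that two of
the counts are coprime (`exists_mem_not_hasRoot`).

*Computability.* For a fixed presentation only the last two entries depend on the word, and their
representing words arise by substituting fixed words for letters (`exists_primrec_evalPair`).
-/

/-! ### Free groups: roots, centralizers and embeddings -/

section FreeGroupFacts

variable {α : Type*}

/-- If a cyclically reduced word represents a `k`-th power `w ^ k`, then it is literally the `k`-fold
repetition of a word, because the reduced form `g v ⋯ v g⁻¹` of `w ^ k` is cyclically reduced only
for `g = 1`. Hence `k` divides the number of occurrences of every letter. -/
theorem FreeGroup.IsCyclicallyReduced.dvd_count_of_mk_eq_pow [DecidableEq α]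
    {L : List (α × Bool)} (hL : FreeGroup.IsCyclicallyReduced L) {w : FreeGroup α} {k : ℕ}
    (h : FreeGroup.mk L = w ^ k) (c : α × Bool) : k ∣ L.count c := by
  have h1 : L = FreeGroup.reduce (List.replicate k w.toWord).flatten := by
    rw [← FreeGroup.toWord_pow, ← h, FreeGroup.toWord_mk, hL.isReduced.reduce_eq]
  rw [FreeGroup.reduceCyclically.reduce_flatten_replicate FreeGroup.isReduced_toWord] at h1
  split_ifs at h1 with hk
  · simp [h1]
  · cases hg : FreeGroup.reduceCyclically.conjugator w.toWord with
    | nil =>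
      rw [hg] at h1
      rw [h1]
      simp [List.count_flatten]
    | cons x t =>
      rw [hg] at h1
      have hlast : L = x :: t ++ (List.replicate k
          (FreeGroup.reduceCyclically w.toWord)).flatten ++ FreeGroup.invRev t ++ [(x.1, !x.2)] := by
        rw [h1]
        simp [FreeGroup.invRev]
      have h2 := hL.2 (x.1, !x.2) (by rw [hlast, List.getLast?_concat]; rfl) x (by simp [h1]) rfl
      simp at h2

theorem FreeGroup.IsCyclicallyReduced.natAbs_dvd_count_of_mk_eq_zpow [DecidableEq α]
    {L : List (α × Bool)} (hL : FreeGroup.IsCyclicallyReduced L) {w : FreeGroup α} {k : ℤ}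
    (h : FreeGroup.mk L = w ^ k) (c : α × Bool) : k.natAbs ∣ L.count c := by
  rcases Int.natAbs_eq k with hk | hk
  · refine hL.dvd_count_of_mk_eq_pow (w := w) ?_ c
    rw [h, ← zpow_natCast, ← hk]
  · refine hL.dvd_count_of_mk_eq_pow (w := w⁻¹) ?_ c
    rw [h, ← zpow_natCast, inv_zpow', ← hk]

/-- The word `y ^ s T y ^ (-s) T` is cyclically reduced if the reduced word `T = ℓ ⋯ ℓ⁻¹` begins
and ends with a letter of another generator than `y`. -/
theorem isCyclicallyReduced_replicate_append {l y : α × Bool} {S : List (α × Bool)}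
    (hT : FreeGroup.IsReduced (l :: S ++ [(l.1, !l.2)])) (hy : y.1 ≠ l.1) (s : ℕ) (hs : s ≠ 0) :
    FreeGroup.IsCyclicallyReduced
      (List.replicate s y ++ (l :: S ++ [(l.1, !l.2)]) ++
        (List.replicate s (y.1, !y.2) ++ (l :: S ++ [(l.1, !l.2)]))) := by
  have hr : ∀ z : α × Bool, FreeGroup.IsReduced (List.replicate s z) := fun z =>
    List.isChain_replicate_of_rel _ (fun _ => rfl)
  obtain ⟨s, rfl⟩ := Nat.exists_eq_succ_of_ne_zero hs
  have h1 : ∀ z : α × Bool, z.1 ≠ l.1 →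
      FreeGroup.IsReduced (List.replicate (s + 1) z ++ (l :: S ++ [(l.1, !l.2)])) := by
    intro z hz
    refine List.isChain_append.2 ⟨hr z, hT, ?_⟩
    intro a ha b hb
    simp [List.getLast?_replicate] at ha hb
    subst ha hb
    exact fun h => absurd h hz
  refine ⟨List.isChain_append.2 ⟨h1 y hy, h1 _ hy, ?_⟩, ?_⟩
  · intro a ha b hb
    rw [← List.append_assoc, List.getLast?_concat] at ha
    simp only [Nat.succ_eq_add_one, List.replicate_succ, List.cons_append, List.head?_cons,
      Option.mem_def, Option.some.injEq] at ha hb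
    subst ha hb
    exact fun h => absurd h.symm hy
  · intro a ha b hb
    rw [← List.append_assoc, ← List.append_assoc, List.getLast?_concat] at ha
    simp only [Nat.succ_eq_add_one, List.replicate_succ, List.cons_append, List.head?_cons,
      Option.mem_def, Option.some.injEq] at ha hb
    subst ha hb
    exact fun h => absurd h.symm hy

/-- A nontrivial normal subgroup of a free group of rank at least two contains an element without
roots. -/
theorem exists_mem_not_hasRoot [Nontrivial α] (N : Subgroup (FreeGroup α)) [N.Normal]
    {R : FreeGroup α} (hR : R ∈ N) (hR1 : R ≠ 1) : ∃ H ∈ N, ¬ HasRoot H := by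
  classical
  have hne : R.toWord ≠ [] := by simpa using hR1
  -- A letter that cancels neither against the first nor, inverted, against the last letter of `R`.
  obtain ⟨l, hl1, hl2⟩ : ∃ l : α × Bool, l ≠ ((R.toWord.head hne).1, !(R.toWord.head hne).2) ∧
      l ≠ R.toWord.getLast hne := by
    obtain ⟨i, j, hij⟩ := exists_pair_ne α
    by_contra! hcon
    have h1 := hcon (i, true)
    have h2 := hcon (i, false)
    have h3 := hcon (j, true)
    have h4 := hcon (j, false)
    generalize R.toWord.head hne = p at *
    generalize R.toWord.getLast hne = q at *
    clear hcon
    obtain ⟨p1, p2⟩ := p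
    obtain ⟨q1, q2⟩ := q
    simp only [ne_eq, Prod.mk.injEq, not_and, Bool.not_eq_not] at h1 h2 h3 h4
    cases p2 <;> cases q2 <;> grind
  have hT : FreeGroup.IsReduced (l :: R.toWord ++ [(l.1, !l.2)]) := by
    have h0 : FreeGroup.IsReduced R.toWord := FreeGroup.isReduced_toWord
    rw [List.cons_append]
    refine List.isChain_cons.2 ⟨?_, List.isChain_append.2 ⟨h0, List.isChain_singleton _, ?_⟩⟩
    · intro y hy h
      rw [List.head?_append_of_ne_nil _ hne, List.head?_eq_some_head hne] at hy
      simp only [Option.mem_def, Option.some.injEq] at hy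
      subst hy
      by_contra hc
      exact hl1 (Prod.ext h (by simpa using Bool.eq_not_of_ne hc))
    · intro a ha b hb h
      rw [List.getLast?_eq_some_getLast hne] at ha
      simp only [Option.mem_def, Option.some.injEq, List.head?_cons] at ha hb
      subst ha hb
      by_contra hc
      refine hl2 (Prod.ext h.symm ?_)
      have := Bool.eq_not_of_ne hc
      simpa using this.symm
  obtain ⟨y, hy⟩ := exists_ne l.1
  set T := l :: R.toWord ++ [(l.1, !l.2)] with hTdef
  -- With this exponent the word has `2 t` letters `l` and `4 t t' + 1` letters `y`, where `t`, `t'`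
  -- are the numbers of such letters in `T`; these two numbers are coprime.
  set s := 2 * T.count (y, true) * (2 * T.count l - 1) + 1 with hs
  have hcyc := isCyclicallyReduced_replicate_append (y := (y, true)) hT hy s (by omega)
  have hTl : 1 ≤ T.count l := List.count_pos_iff.2 (by simp [hTdef])
  have hTN : FreeGroup.mk T ∈ N := by
    have : FreeGroup.mk T = FreeGroup.mk [l] * R * (FreeGroup.mk [l])⁻¹ := by
      conv_rhs => rw [← FreeGroup.mk_toWord (x := R)]
      simp [FreeGroup.mul_mk, FreeGroup.inv_mk, FreeGroup.invRev, hTdef]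
    rw [this]
    exact Subgroup.Normal.conj_mem ‹_› R hR _
  refine ⟨FreeGroup.mk (List.replicate s (y, true) ++ T ++ (List.replicate s (y, !true) ++ T)),
    ?_, ?_⟩
  rotate_left
  · rintro ⟨w, k, hk1, hk2, hw⟩
    have e1 := hcyc.natAbs_dvd_count_of_mk_eq_zpow hw l
    have e2 := hcyc.natAbs_dvd_count_of_mk_eq_zpow hw (y, true)
    have hne1 : (y, true) ≠ l := fun h => hy (congrArg Prod.fst h)
    have hne2 : (y, false) ≠ l := fun h => hy (congrArg Prod.fst h)
    rw [← hTdef] at e1 e2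
    simp only [List.count_append, List.count_replicate] at e1 e2
    simp [hne1, hne2] at e1 e2
    obtain ⟨t, ht⟩ := Nat.exists_eq_add_of_le hTl
    have e3 : s + T.count (y, true) + T.count (y, true) =
        2 * T.count (y, true) * (T.count l + T.count l) + 1 := by
      rw [hs, ht]
      have : 2 * (1 + t) - 1 = 2 * t + 1 := by omega
      rw [this]
      ring
    rw [e3] at e2
    have e4 := (Nat.dvd_add_right (e1.mul_left (2 * T.count (y, true)))).1 e2
    have := Nat.dvd_one.1 e4
    omega
  · have : FreeGroup.mk (List.replicate s (y, true) ++ T ++ (List.replicate s (y, !true) ++ T)) =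
        FreeGroup.of y ^ s * FreeGroup.mk T * (FreeGroup.of y ^ s)⁻¹ * FreeGroup.mk T := by
      simp [FreeGroup.of, FreeGroup.pow_mk, FreeGroup.mul_mk, FreeGroup.inv_mk, FreeGroup.invRev]
    rw [this]
    exact N.mul_mem (Subgroup.Normal.conj_mem ‹_› _ hTN _) hTN

theorem FreeGroup.of_commute_of {a b : α} (h : Commute (FreeGroup.of a) (FreeGroup.of b)) :
    a = b := by
  classical
  have h1 := congrArg FreeGroup.toWord h.eq
  by_contra hab
  simp [FreeGroup.of, FreeGroup.mul_mk, FreeGroup.reduce, hab, Ne.symm hab] at h1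

/-- Commuting elements of a free group are powers of a common element: by the Nielsen–Schreier
theorem they generate a free group, and an abelian free group has rank at most one. -/
theorem Commute.exists_zpow_of_isFreeGroup {G : Type*} [Group G] [IsFreeGroup G] {x y : G}
    (h : Commute x y) : ∃ z : G, x ∈ Subgroup.zpowers z ∧ y ∈ Subgroup.zpowers z := by
  set K := Subgroup.closure ({x, y} : Set G)
  have hx : x ∈ K := Subgroup.subset_closure (by simp)
  have hy : y ∈ K := Subgroup.subset_closure (by simp)
  have hcomm : ∀ a b : K, a * b = b * a := by
    have := Subgroup.isMulCommutative_closure (k := ({x, y} : Set G)) (by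
      rintro a (rfl | rfl) b (rfl | rfl)
      exacts [rfl, h.eq, h.eq.symm, rfl])
    exact this.is_comm.comm
  have hsub : Subsingleton (IsFreeGroup.Generators K) := by
    refine ⟨fun a b => FreeGroup.of_commute_of ?_⟩
    apply (IsFreeGroup.mulEquiv K).injective
    simp only [map_mul]
    exact hcomm _ _
  obtain ⟨z, hz⟩ : ∃ z : K, ∀ g : K, g ∈ Subgroup.zpowers z := by
    rcases isEmpty_or_nonempty (IsFreeGroup.Generators K) with he | ⟨⟨a⟩⟩
    · refine ⟨1, fun g => ?_⟩
      have : g = 1 := (IsFreeGroup.mulEquiv K).symm.injective (Subsingleton.elim _ _)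
      simp [this]
    · refine ⟨IsFreeGroup.of a, fun g => ?_⟩
      have hcl := FreeGroup.closure_range_of (IsFreeGroup.Generators K)
      have hmem : (IsFreeGroup.mulEquiv K).symm g ∈ Subgroup.zpowers (FreeGroup.of a) := by
        rw [Subgroup.zpowers_eq_closure]
        refine Subgroup.closure_mono ?_ (hcl ▸ Subgroup.mem_top _ :
          (IsFreeGroup.mulEquiv K).symm g ∈ Subgroup.closure (Set.range FreeGroup.of))
        rintro _ ⟨b, rfl⟩
        rw [Subsingleton.elim b a]
        rfl
      obtain ⟨k, hk⟩ := Subgroup.mem_zpowers_iff.1 hmem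
      refine Subgroup.mem_zpowers_iff.2 ⟨k, ?_⟩
      apply (IsFreeGroup.mulEquiv K).symm.injective
      rw [map_zpow, ← hk]
      simp [IsFreeGroup.of]
  refine ⟨z, ?_, ?_⟩
  · obtain ⟨k, hk⟩ := Subgroup.mem_zpowers_iff.1 (hz ⟨x, hx⟩)
    exact Subgroup.mem_zpowers_iff.2 ⟨k, by simpa using congrArg Subtype.val hk⟩
  · obtain ⟨k, hk⟩ := Subgroup.mem_zpowers_iff.1 (hz ⟨y, hy⟩)
    exact Subgroup.mem_zpowers_iff.2 ⟨k, by simpa using congrArg Subtype.val hk⟩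

/-- In a free group the centralizer of an element without roots is generated by that element. -/
theorem Commute.mem_zpowers_of_not_hasRoot {G : Type*} [Group G] [IsFreeGroup G] {x y : G}
    (h : Commute x y) (hx : ¬ HasRoot x) : y ∈ Subgroup.zpowers x := by
  obtain ⟨z, hxz, hyz⟩ := h.exists_zpow_of_isFreeGroup
  obtain ⟨k, rfl⟩ := Subgroup.mem_zpowers_iff.1 hxz
  have hk : k = 1 ∨ k = -1 := by
    by_contra! hk
    exact hx ⟨z, k, hk.1, hk.2, rfl⟩
  rcases hk with rfl | rfl <;> simpa using hyz

/-- The shift of the generators of the free group on `ℤ`, as an action of `ℤ`. -/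
def freeGroupShift : Multiplicative ℤ →* MulAut (FreeGroup ℤ) :=
  zpowersHom (MulAut (FreeGroup ℤ)) (FreeGroup.freeGroupCongr (Equiv.addRight 1))

/-- The conjugates `x ^ i y x ^ (-i)` freely generate a subgroup of the free group on `x`, `y`:
the homomorphism to `FreeGroup ℤ ⋊ ℤ` that sends `y` to the generator of index `0` and `x` to the
shift maps `x ^ i y x ^ (-i)` to the generator of index `i`. -/
theorem freeGroup_lift_conj_injective (r : ℕ) :
    Function.Injective (FreeGroup.lift fun i : Fin r =>
      FreeGroup.of (0 : Fin 2) ^ (i : ℕ) * FreeGroup.of 1 * (FreeGroup.of 0 ^ (i : ℕ))⁻¹) := by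
  let ψ : FreeGroup (Fin 2) →* FreeGroup ℤ ⋊[freeGroupShift] Multiplicative ℤ :=
    FreeGroup.lift ![SemidirectProduct.inr (Multiplicative.ofAdd 1),
      SemidirectProduct.inl (FreeGroup.of 0)]
  have key : ∀ i : ℕ, ψ (FreeGroup.of 0 ^ i * FreeGroup.of 1 * (FreeGroup.of 0 ^ i)⁻¹) =
      SemidirectProduct.inl (FreeGroup.of (i : ℤ)) := by
    intro i
    induction i with
    | zero => simp [ψ]
    | succ i ih =>
      rw [pow_succ', mul_inv_rev]
      have : FreeGroup.of (0 : Fin 2) * FreeGroup.of 0 ^ i * FreeGroup.of 1 *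
          ((FreeGroup.of 0 ^ i)⁻¹ * (FreeGroup.of 0)⁻¹) = FreeGroup.of 0 *
          (FreeGroup.of 0 ^ i * FreeGroup.of 1 * (FreeGroup.of 0 ^ i)⁻¹) * (FreeGroup.of 0)⁻¹ := by
        group
      rw [this, map_mul, map_mul, ih, map_inv]
      have h0 : ψ (FreeGroup.of 0) = SemidirectProduct.inr (Multiplicative.ofAdd 1) := by simp [ψ]
      rw [h0, ← map_inv, ← SemidirectProduct.inl_aut]
      simp [freeGroupShift]
  have hcomp : (ψ.comp (FreeGroup.lift fun i : Fin r =>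
      FreeGroup.of (0 : Fin 2) ^ (i : ℕ) * FreeGroup.of 1 * (FreeGroup.of 0 ^ (i : ℕ))⁻¹)) =
      SemidirectProduct.inl.comp (FreeGroup.map fun i : Fin r => ((i : ℕ) : ℤ)) := by
    ext1 i
    simp [-map_mul, key]
  have hinj : Function.Injective (FreeGroup.map fun i : Fin r => ((i : ℕ) : ℤ)) :=
    FreeGroup.map_injective (fun a b h => by simpa [Fin.ext_iff] using h)
  have := (SemidirectProduct.inl_injective (φ := freeGroupShift)).comp hinj
  rw [← MonoidHom.coe_comp, ← hcomp, MonoidHom.coe_comp] at this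
  exact this.of_comp

theorem nonempty_FTLChoice : Nonempty FTLChoice := by
  have hH : ∀ (P : FinPresentation), P.InGS → ∃ H : FreeGroup (Fin P.n),
      H ∈ Subgroup.normalClosure (Set.range P.relator) ∧ ¬ HasRoot H := by
    rintro P ⟨hn, j, hj⟩
    have : Nontrivial (Fin P.n) := Fin.nontrivial_iff_two_le.2 hn
    exact exists_mem_not_hasRoot _ (Subgroup.subset_normalClosure ⟨j, rfl⟩) hj
  choose H hH using hH
  exact ⟨{ emb := fun r s => MonoidHom.prodMap (FreeGroup.lift _) (FreeGroup.lift _)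
           emb_injective := fun r s => Function.Injective.prodMap
            (freeGroup_lift_conj_injective r) (freeGroup_lift_conj_injective s)
           H := H
           H_mem := fun P hP => (hH P hP).1
           H_noRoot := fun P hP => (hH P hP).2 }⟩

end FreeGroupFacts

/-! ### Hurwitz moves on lists -/

section HurwitzLists

variable {G : Type*} [Group G]

/-- One Hurwitz move `(…, x, y, …) ↦ (…, y, y⁻¹ x y, …)` on a list of group elements. -/
inductive HurwitzStep : List G → List G → Prop
  | intro (l₁ : List G) (x y : G) (l₂ : List G) :
      HurwitzStep (l₁ ++ x :: y :: l₂) (l₁ ++ y :: (y⁻¹ * x * y) :: l₂)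

/-- Hurwitz equivalence of lists. Lists are easier to cut into blocks than vectors. -/
abbrev ListHurwitz : List G → List G → Prop := Relation.EqvGen HurwitzStep

theorem ListHurwitz.symm {l l' : List G} (h : ListHurwitz l l') : ListHurwitz l' l :=
  Relation.EqvGen.symm _ _ h

theorem HurwitzEquiv.refl {n : ℕ} (F : Fin n → G) : HurwitzEquiv F F :=
  ⟨1, hurwitzAct_one F⟩

theorem HurwitzEquiv.symm {n : ℕ} {F K : Fin n → G} (h : HurwitzEquiv F K) :
    HurwitzEquiv K F := by
  obtain ⟨b, rfl⟩ := h
  exact ⟨b⁻¹, by rw [← hurwitzAct_mul, mul_inv_cancel, hurwitzAct_one]⟩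

theorem HurwitzEquiv.trans {n : ℕ} {F K L : Fin n → G} (h : HurwitzEquiv F K)
    (h' : HurwitzEquiv K L) : HurwitzEquiv F L := by
  obtain ⟨b, rfl⟩ := h
  obtain ⟨c, rfl⟩ := h'
  exact ⟨b * c, hurwitzAct_mul F b c⟩

theorem HurwitzStep.length_eq {l l' : List G} (h : HurwitzStep l l') : l.length = l'.length := by
  cases h; simp

theorem ListHurwitz.length_eq {l l' : List G} (h : ListHurwitz l l') : l.length = l'.length := by
  induction h with
  | rel _ _ h => exact h.length_eq
  | refl _ => rfl
  | symm _ _ _ ih => exact ih.symm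
  | trans _ _ _ _ _ ih ih' => exact ih.trans ih'

theorem HurwitzStep.hurwitzEquiv {n : ℕ} {F K : Fin n → G}
    (h : HurwitzStep (List.ofFn F) (List.ofFn K)) : HurwitzEquiv F K := by
  generalize hl : List.ofFn F = l at h
  generalize hl' : List.ofFn K = l' at h
  obtain ⟨l₁, x, y, l₂⟩ := h
  have hlen : n = l₁.length + (l₂.length + 2) := by simpa using congrArg List.length hl
  have hF : ∀ (i : ℕ) (hi : i < n), some (F ⟨i, hi⟩) = (l₁ ++ x :: y :: l₂)[i]? := by
    intro i hi
    rw [← hl]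
    simp [hi]
  have hK : ∀ (i : ℕ) (hi : i < n),
      some (K ⟨i, hi⟩) = (l₁ ++ y :: (y⁻¹ * x * y) :: l₂)[i]? := by
    intro i hi
    rw [← hl']
    simp [hi]
  let i : Fin (n - 1) := ⟨l₁.length, by omega⟩
  have hx : F (posL i) = x := by
    have := hF l₁.length (by omega)
    simpa [posL, i] using this
  have hy : F (posR i) = y := by
    have := hF (l₁.length + 1) (by omega)
    simpa [List.getElem?_append_right, posR, i] using this
  refine ⟨braidGen i, ?_⟩
  rw [hurwitzAct_braidGen]
  funext k
  apply Option.some_injective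
  rw [hK k k.2]
  have hkF := hF k k.2
  unfold hurwitzMove
  rw [hx, hy]
  rcases lt_trichotomy (k : ℕ) l₁.length with hk | hk | hk
  · have h1 : k ≠ posL i := fun h => by simp [posL, i, h] at hk
    have h2 : k ≠ posR i := fun h => by simp [posR, i, h] at hk
    rw [List.getElem?_append_left hk] at hkF ⊢
    simpa [h1, h2] using hkF
  · have h1 : k = posL i := Fin.ext hk
    simp [h1, posL, i]
  · obtain ⟨d, hd⟩ := Nat.exists_eq_add_of_lt hk
    have h1 : k ≠ posL i := fun h => by simp [posL, i, h] at hk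
    rw [List.getElem?_append_right hk.le] at hkF ⊢
    rcases d with _ | d
    · have h2 : k = posR i := Fin.ext (by simpa [posR, i] using hd)
      have h3 : (k : ℕ) - l₁.length = 1 := by omega
      rw [h3]
      simp [h2, posR_ne_posL]
    · have h2 : k ≠ posR i := fun h => by simp [posR, i, h] at hd
      have h3 : (k : ℕ) - l₁.length = d + 2 := by omega
      rw [h3] at hkF ⊢
      simpa [h1, h2] using hkF

theorem ListHurwitz.hurwitzEquiv {n : ℕ} {F K : Fin n → G}
    (h : ListHurwitz (List.ofFn F) (List.ofFn K)) : HurwitzEquiv F K := by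
  generalize hl : List.ofFn F = l at h
  generalize hl' : List.ofFn K = l' at h
  induction h generalizing F K with
  | rel _ _ h => exact HurwitzStep.hurwitzEquiv (by rwa [hl, hl'])
  | refl _ =>
    rw [List.ofFn_injective (hl.trans hl'.symm)]
    exact HurwitzEquiv.refl K
  | symm _ _ _ ih => exact (ih hl' hl).symm
  | trans _ m _ h _ ih ih' =>
    have hm : m.length = n := by rw [← ListHurwitz.length_eq h, ← hl, List.length_ofFn]
    subst hm
    exact (ih hl (List.ofFn_get m)).trans (ih' (List.ofFn_get m) hl')

theorem ListHurwitz.map {G' : Type*} [Group G'] (f : G →* G') {l l' : List G}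
    (h : ListHurwitz l l') : ListHurwitz (l.map f) (l'.map f) := by
  induction h with
  | rel _ _ h =>
    obtain ⟨l₁, x, y, l₂⟩ := h
    refine .rel _ _ ?_
    simpa using HurwitzStep.intro (l₁.map f) (f x) (f y) (l₂.map f)
  | refl _ => exact .refl _
  | symm _ _ _ ih => exact ih.symm
  | trans _ _ _ _ _ ih ih' => exact ih.trans _ _ _ ih'

theorem ListHurwitz.append_append {l l' : List G} (h : ListHurwitz l l') (a b : List G) :
    ListHurwitz (a ++ l ++ b) (a ++ l' ++ b) := by
  induction h with
  | rel _ _ h =>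
    obtain ⟨l₁, x, y, l₂⟩ := h
    refine .rel _ _ ?_
    simpa using HurwitzStep.intro (a ++ l₁) x y (l₂ ++ b)
  | refl _ => exact .refl _
  | symm _ _ _ ih => exact ih.symm
  | trans _ _ _ _ _ ih ih' => exact ih.trans _ _ _ ih'

theorem ListHurwitz.append_left {l l' : List G} (h : ListHurwitz l l') (a : List G) :
    ListHurwitz (a ++ l) (a ++ l') := by
  simpa using h.append_append a []

theorem ListHurwitz.append_right {l l' : List G} (h : ListHurwitz l l') (b : List G) :
    ListHurwitz (l ++ b) (l' ++ b) := by
  simpa using h.append_append [] b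

theorem listHurwitz_append_singleton (l : List G) (g : G) :
    ListHurwitz (l ++ [g]) (g :: l.map fun x => g⁻¹ * x * g) := by
  induction l with
  | nil => exact .refl _
  | cons x l ih =>
    refine (ih.append_left [x]).trans _ _ _ (.rel _ _ ?_)
    exact HurwitzStep.intro [] x g _

theorem listHurwitz_cons (l : List G) (g : G) :
    ListHurwitz (g :: l) (l ++ [l.prod⁻¹ * g * l.prod]) := by
  induction l generalizing g with
  | nil => simpa using Relation.EqvGen.refl _
  | cons x l ih =>
    refine (Relation.EqvGen.rel _ _ (HurwitzStep.intro [] g x l)).trans _ _ _ ?_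
    simpa [mul_assoc] using (ih (x⁻¹ * g * x)).append_left [x]

/-- A block with product `1` can be moved past any other block. -/
theorem listHurwitz_append_comm {l : List G} (hl : l.prod = 1) (m : List G) :
    ListHurwitz (l ++ m) (m ++ l) := by
  induction m with
  | nil => simpa using Relation.EqvGen.refl _
  | cons g m ih =>
    have h1 := (listHurwitz_cons l g).symm.append_right m
    rw [hl] at h1
    simp only [inv_one, one_mul, mul_one, List.append_assoc, List.cons_append] at h1
    exact h1.trans _ _ _ (ih.append_left [g])

theorem List.prod_map_conj (l : List G) (g : G) :
    (l.map fun x => g⁻¹ * x * g).prod = g⁻¹ * l.prod * g := by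
  induction l with
  | nil => simp
  | cons x l ih =>
    rw [List.map_cons, List.prod_cons, ih, List.prod_cons]
    group

/-- A block with product `1` can be conjugated by every element of the subgroup that the remaining
entries generate, the remaining entries being restored: move the block next to an entry and let it
pass that entry in the two possible ways. -/
theorem listHurwitz_conj_append {l m : List G} (hl : l.prod = 1) {g : G}
    (hg : g ∈ Subgroup.closure {x | x ∈ m}) :
    ListHurwitz (l ++ m) ((l.map fun x => g⁻¹ * x * g) ++ m) := by
  have hprod : ∀ (l : List G) (g : G), l.prod = 1 → (l.map fun x => g⁻¹ * x * g).prod = 1 := by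
    intro l g h
    rw [List.prod_map_conj, h]
    simp
  induction hg using Subgroup.closure_induction generalizing l with
  | mem g hg =>
    obtain ⟨m₁, m₂, rfl⟩ := List.append_of_mem hg
    have h1 := (listHurwitz_append_comm hl m₁).append_right (g :: m₂)
    have h2 := ((listHurwitz_append_singleton l g).append_append m₁ m₂)
    have h3 := (listHurwitz_append_comm (hprod l g hl) (m₁ ++ [g])).append_right m₂
    simp only [List.append_assoc, List.cons_append, List.nil_append] at h1 h2 h3 ⊢
    exact (h1.trans _ _ _ h2).trans _ _ _ h3.symm
  | one => simpa using Relation.EqvGen.refl _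
  | mul x y _ _ hx hy =>
    have := (hx hl).trans _ _ _ (hy (hprod l x hl))
    simpa [mul_assoc, Function.comp_def] using this
  | inv x _ hx =>
    have := hx (hprod l x⁻¹ hl)
    simpa [mul_assoc, Function.comp_def] using this.symm

/-- With three blocks `c`, `l`, `m` of product `1`, the block `c` can be conjugated by every
conjugate `g⁻¹ r g` of an entry `r` of `l` by an element `g` of the subgroup generated by `m`, the
other two blocks being restored: conjugate `l` by `g`, then `c` by the entry `g⁻¹ r g`, and undo the
first step. -/
theorem listHurwitz_conj_append_append {c l m : List G} (hc : c.prod = 1) (hl : l.prod = 1) {u : G}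
    (hu : u ∈ Subgroup.closure
      {x | ∃ r ∈ l, ∃ g ∈ Subgroup.closure {x | x ∈ m}, g⁻¹ * r * g = x}) :
    ListHurwitz (l ++ m ++ c) (l ++ m ++ c.map fun x => u⁻¹ * x * u) := by
  have hprod : ∀ (l : List G) (g : G), l.prod = 1 → (l.map fun x => g⁻¹ * x * g).prod = 1 := by
    intro l g h
    rw [List.prod_map_conj, h]
    simp
  induction hu using Subgroup.closure_induction generalizing c with
  | mem u hu =>
    obtain ⟨r, hr, g, hg, rfl⟩ := hu
    have h1 := listHurwitz_conj_append hl hg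
    have hmem : g⁻¹ * r * g ∈ (l.map fun x => g⁻¹ * x * g) ++ m :=
      List.mem_append_left _ (List.mem_map.2 ⟨r, hr, rfl⟩)
    have h2 := listHurwitz_conj_append hc (Subgroup.subset_closure hmem)
    refine (listHurwitz_append_comm hc _).symm.trans _ _ _ ?_
    refine (h1.append_left c).trans _ _ _ (h2.trans _ _ _ ?_)
    exact (h1.symm.append_left _).trans _ _ _ (listHurwitz_append_comm (hprod _ _ hc) _)
  | one => simpa using Relation.EqvGen.refl _
  | mul x y _ _ hx hy =>
    have := (hx hc).trans _ _ _ (hy (hprod c x hc))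
    simpa [mul_assoc, Function.comp_def] using this
  | inv x _ hx =>
    have := hx (hprod c x⁻¹ hc)
    simpa [mul_assoc, Function.comp_def] using this.symm

/-- A set that is closed under conjugation of its elements by each other and contains the entries of
a vector contains the entries of every Hurwitz equivalent vector. -/
theorem HurwitzEquiv.mem_of_forall_mem {n : ℕ} {F K : Fin n → G} (h : HurwitzEquiv F K)
    {Y : Set G} (h₁ : ∀ x ∈ Y, ∀ y ∈ Y, y⁻¹ * x * y ∈ Y) (h₂ : ∀ x ∈ Y, ∀ y ∈ Y, x * y * x⁻¹ ∈ Y)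
    (hF : ∀ k, F k ∈ Y) (k : Fin n) : K k ∈ Y := by
  obtain ⟨b, rfl⟩ := h
  have hb : b ∈ Subgroup.closure (Set.range (braidGen (n := n))) :=
    (PresentedGroup.closure_range_of {r | BraidRel n r}).symm ▸ Subgroup.mem_top b
  induction hb using Subgroup.closure_induction'' generalizing F k with
  | mem x hx =>
    obtain ⟨i, rfl⟩ := hx
    rw [hurwitzAct_braidGen]
    unfold hurwitzMove
    split_ifs
    exacts [hF _, h₁ _ (hF _) _ (hF _), hF _]
  | inv_mem x hx =>
    obtain ⟨i, rfl⟩ := hx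
    have : hurwitzAct F (braidGen i)⁻¹ = hurwitzMoveInv i F := by
      simp only [hurwitzAct, hurwitzHom, braidGen, map_inv, PresentedGroup.toGroup.of]
      rfl
    rw [this]
    unfold hurwitzMoveInv
    split_ifs
    exacts [h₂ _ (hF _) _ (hF _), hF _, hF _]
  | one => rw [hurwitzAct_one]; exact hF k
  | mul x y _ _ hx hy =>
    rw [hurwitzAct_mul]
    exact hy (fun k => hx hF k) k

end HurwitzLists

/-! ### The blocks of the factorization -/

section Blocks

theorem ofFn_closeUp {G : Type*} [Group G] {k : ℕ} (v : Fin k → G) :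
    List.ofFn (closeUp v) = List.ofFn v ++ [((List.ofFn v).prod)⁻¹] := by
  unfold closeUp
  rw [List.ofFn_succ']
  simp

theorem prod_ofFn_closeUp {G : Type*} [Group G] {k : ℕ} (v : Fin k → G) :
    (List.ofFn (closeUp v)).prod = 1 := by
  rw [ofFn_closeUp]
  simp

theorem closeUp_mem {G : Type*} [Group G] {k : ℕ} {v : Fin k → G} {S : Subgroup G}
    (h : ∀ i, v i ∈ S) {x : G} (hx : x ∈ List.ofFn (closeUp v)) : x ∈ S := by
  have h' : ∀ y ∈ List.ofFn v, y ∈ S := by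
    intro y hy
    obtain ⟨i, rfl⟩ := List.mem_ofFn.1 hy
    exact h i
  rw [ofFn_closeUp, List.mem_append, List.mem_singleton] at hx
  rcases hx with hx | rfl
  · exact h' x hx
  · exact S.inv_mem (S.list_prod_mem h')

theorem closeUp_map {G G' : Type*} [Group G] [Group G'] (f : G →* G') {k : ℕ} (v : Fin k → G)
    (j : Fin (k + 1)) : f (closeUp v j) = closeUp (fun i => f (v i)) j := by
  refine Fin.lastCases ?_ (fun i => ?_) j
  · simp [closeUp, map_list_prod, List.map_ofFn, Function.comp_def]
  · simp [closeUp]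

theorem closeUp_prodMk {G G' : Type*} [Group G] [Group G'] {k : ℕ} (v : Fin k → G)
    (v' : Fin k → G') (j : Fin (k + 1)) :
    closeUp (fun i => (v i, v' i)) j = (closeUp v j, closeUp v' j) :=
  Prod.ext (closeUp_map (MonoidHom.fst G G') (fun i => (v i, v' i)) j)
    (closeUp_map (MonoidHom.snd G G') (fun i => (v i, v' i)) j)

theorem closeUp_one {G : Type*} [Group G] {k : ℕ} (j : Fin (k + 1)) :
    closeUp (fun _ : Fin k => (1 : G)) j = 1 := by
  refine Fin.lastCases ?_ (fun i => ?_) j <;> simp [closeUp]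

variable (P : FinPresentation)

/-- The block `(R₁, 1), …, (R_m, 1), ((R₁ ⋯ R_m)⁻¹, 1)`. -/
def relBlock : List (FreeGroup (Fin P.n) × FreeGroup (Fin (P.n + 1))) :=
  List.ofFn (closeUp fun j => (P.relator j, 1))

/-- The block `(z₁, X₁), …, (z_n, X_n), ((z₁ ⋯ z_n)⁻¹, (X₁ ⋯ X_n)⁻¹)`. -/
def genBlock (n : ℕ) : List (FreeGroup (Fin n) × FreeGroup (Fin (n + 1))) :=
  List.ofFn (closeUp fun i => (FreeGroup.of i, FreeGroup.of i.castSucc))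

/-- The block `(c⁻¹, X_{n+1}⁻¹), (c, X_{n+1})`. -/
def lastBlock {n : ℕ} (c : FreeGroup (Fin n)) :
    List (FreeGroup (Fin n) × FreeGroup (Fin (n + 1))) :=
  [(c⁻¹, (FreeGroup.of (Fin.last n))⁻¹), (c, FreeGroup.of (Fin.last n))]

theorem relBlock_prod : (relBlock P).prod = 1 := prod_ofFn_closeUp _

theorem genBlock_prod (n : ℕ) : (genBlock n).prod = 1 := prod_ofFn_closeUp _

theorem lastBlock_prod {n : ℕ} (c : FreeGroup (Fin n)) : (lastBlock c).prod = 1 := by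
  simp [lastBlock]

theorem lastBlock_map_conj {n : ℕ} (c u : FreeGroup (Fin n)) :
    (lastBlock c).map (fun x => (u, 1)⁻¹ * x * (u, 1)) = lastBlock (u⁻¹ * c * u) := by
  simp [lastBlock, mul_assoc]

theorem ofFn_pFactorization (c : FreeGroup (Fin P.n)) :
    List.ofFn (pFactorization (xVector P.n) (closeUp P.relator) (closeUp FreeGroup.of) c) =
      relBlock P ++ genBlock P.n ++ lastBlock c := by
  have h1 : relBlock P = List.ofFn fun j => (closeUp P.relator j, 1) := by
    unfold relBlock
    congr 1
    funext j
    rw [closeUp_prodMk, closeUp_one]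
  have h2 : genBlock P.n = List.ofFn fun j => (closeUp FreeGroup.of j,
      closeUp (fun i : Fin P.n => FreeGroup.of i.castSucc) j) := by
    unfold genBlock
    congr 1
    funext j
    rw [closeUp_prodMk]
  unfold pFactorization
  rw [List.ofFn_fin_append, List.ofFn_fin_append, ← h1, List.append_assoc, h2]
  congr 2
  · congr 1
    funext j
    simp [xVector]
  · simp only [xVector, lastBlock, Fin.append_right]
    simp

theorem ofFn_ftlS1 (C : FTLChoice) (c : FreeGroup (Fin P.n)) :
    List.ofFn (C.ftlS1 P c) =
      (relBlock P ++ genBlock P.n ++ lastBlock c).map (C.emb P.n (P.n + 1)) := by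
  rw [← ofFn_pFactorization, List.map_ofFn]
  rfl

theorem isFactorization_ftlS1 (C : FTLChoice) (c : FreeGroup (Fin P.n)) :
    IsFactorization 1 (C.ftlS1 P c) := by
  unfold IsFactorization
  rw [ofFn_ftlS1, ← map_list_prod]
  simp [relBlock_prod, genBlock_prod, lastBlock_prod]

end Blocks

/-! ### Equal elements give Hurwitz equivalent factorizations -/

section Equivalence

variable (P : FinPresentation)

/-- Every element of the normal closure of the relators, as an element of the first factor, is
generated by conjugates of the relator block by elements of the group generated by the generator
block, since the latter projects onto the first factor. -/
theorem mk_one_mem_closure_conj {u : FreeGroup (Fin P.n)}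
    (hu : u ∈ Subgroup.normalClosure (Set.range P.relator)) :
    (u, 1) ∈ Subgroup.closure {x | ∃ r ∈ relBlock P,
      ∃ g ∈ Subgroup.closure {x | x ∈ genBlock P.n}, g⁻¹ * r * g = x} := by
  have hsurj : ∀ w : FreeGroup (Fin P.n),
      ∃ g ∈ Subgroup.closure {x | x ∈ genBlock P.n}, g.1 = w := by
    intro w
    have : w ∈ (Subgroup.closure {x | x ∈ genBlock P.n}).map (MonoidHom.fst _ _) := by
      refine (?_ : (⊤ : Subgroup (FreeGroup (Fin P.n))) ≤ _) (Subgroup.mem_top w)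
      rw [← FreeGroup.closure_range_of, Subgroup.closure_le]
      rintro _ ⟨i, rfl⟩
      refine ⟨(FreeGroup.of i, FreeGroup.of i.castSucc), Subgroup.subset_closure ?_, rfl⟩
      simp only [genBlock, ofFn_closeUp, Set.mem_ofPred_eq]
      exact List.mem_append_left _ (List.mem_ofFn.2 ⟨i, rfl⟩)
    obtain ⟨g, hg, rfl⟩ := this
    exact ⟨g, hg, rfl⟩
  have hle : Subgroup.normalClosure (Set.range P.relator) ≤
      (Subgroup.closure {x | ∃ r ∈ relBlock P,
        ∃ g ∈ Subgroup.closure {x | x ∈ genBlock P.n}, g⁻¹ * r * g = x}).comap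
        (MonoidHom.inl _ (FreeGroup (Fin (P.n + 1)))) := by
    refine (Subgroup.closure_le _).2 fun x hx => ?_
    obtain ⟨_, ⟨j, rfl⟩, hj⟩ := Group.mem_conjugatesOfSet_iff.1 hx
    obtain ⟨w, rfl⟩ := isConj_iff.1 hj
    obtain ⟨g, hg, hgw⟩ := hsurj w⁻¹
    refine Subgroup.subset_closure ⟨(P.relator j, 1), ?_, g, hg, ?_⟩
    · simp only [relBlock, ofFn_closeUp]
      exact List.mem_append_left _ (List.mem_ofFn.2 ⟨j, rfl⟩)
    · ext <;> simp [hgw]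
  exact hle hu

theorem hurwitzEquiv_ftlS1_conj (C : FTLChoice) (c : FreeGroup (Fin P.n)) {u : FreeGroup (Fin P.n)}
    (hu : u ∈ Subgroup.normalClosure (Set.range P.relator)) :
    HurwitzEquiv (C.ftlS1 P c) (C.ftlS1 P (u⁻¹ * c * u)) := by
  apply ListHurwitz.hurwitzEquiv
  rw [ofFn_ftlS1, ofFn_ftlS1, ← lastBlock_map_conj]
  exact (listHurwitz_conj_append_append (lastBlock_prod c) (relBlock_prod P)
    (mk_one_mem_closure_conj P hu)).map _

end Equivalence

/-! ### Hurwitz equivalent factorizations come from equal elements -/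

section Converse

variable (P : FinPresentation)

/-- The homomorphism `F_{n+1} → ⟨z₁, …, z_n ∣ R₁, …, R_m⟩` with `X_i ↦ z_i` and `X_{n+1} ↦ 1`. -/
def graphHom : FreeGroup (Fin (P.n + 1)) →* P.Grp :=
  FreeGroup.lift (Fin.snoc (α := fun _ => P.Grp) (fun i => PresentedGroup.of i) 1)

/-- The pairs `(x, y)` such that `x` represents the image of `y` under `graphHom`. If `c` is trivial
in the presented group, this subgroup contains all entries of the factorization. -/
def graphSubgroup : Subgroup (FreeGroup (Fin P.n) × FreeGroup (Fin (P.n + 1))) :=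
  ((PresentedGroup.mk (Set.range P.relator)).comp (MonoidHom.fst _ _)).eqLocus
    ((graphHom P).comp (MonoidHom.snd _ _))

theorem mem_graphSubgroup {p : FreeGroup (Fin P.n) × FreeGroup (Fin (P.n + 1))} :
    p ∈ graphSubgroup P ↔ PresentedGroup.mk (Set.range P.relator) p.1 = graphHom P p.2 := Iff.rfl

/-- The exponent sum of the last generator. -/
def lastExponent (n : ℕ) : FreeGroup (Fin (n + 1)) →* Multiplicative ℤ :=
  FreeGroup.lift fun i => if i = Fin.last n then Multiplicative.ofAdd 1 else 1

theorem lastExponent_of_last (n : ℕ) :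
    lastExponent n (FreeGroup.of (Fin.last n)) = Multiplicative.ofAdd 1 := by
  simp [lastExponent]

theorem not_hasRoot_of_last (n : ℕ) : ¬ HasRoot (FreeGroup.of (Fin.last n)) := by
  rintro ⟨w, k, hk1, hk2, h⟩
  have h1 := congrArg (fun x => Multiplicative.toAdd (lastExponent n x)) h
  simp only [lastExponent_of_last, map_zpow, toAdd_ofAdd, toAdd_zpow, smul_eq_mul] at h1
  rcases Int.isUnit_iff.1 (IsUnit.of_mul_eq_one _ h1.symm) with h | h
  exacts [hk1 h, hk2 h]

theorem presentedGroup_mk_eq_one {x : FreeGroup (Fin P.n)} :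
    PresentedGroup.mk (Set.range P.relator) x = 1 ↔
      x ∈ Subgroup.normalClosure (Set.range P.relator) :=
  QuotientGroup.eq_one_iff x

/-- If the factorizations for `c` and `c'`, with `c` trivial in the presented group, are Hurwitz
equivalent, then `c'` is conjugate to `c` by an element that is trivial in the presented group. All
entries that occur are conjugates of the original ones by elements `(u, v)` of `graphSubgroup`, and
`(c', X_{n+1})` must come from `(c, X_{n+1})`, the only entry in which `X_{n+1}` has positive
exponent sum. Then `v` is a power of `X_{n+1}`, so that `u` is trivial in the presented group. -/
theorem exists_conj_of_hurwitzEquiv {K : Type*} [Group K]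
    {f : FreeGroup (Fin P.n) × FreeGroup (Fin (P.n + 1)) →* K} (hf : Function.Injective f)
    {N : ℕ} {F F' : Fin N → K} {c c' : FreeGroup (Fin P.n)}
    (hc : c ∈ Subgroup.normalClosure (Set.range P.relator))
    (hF : List.ofFn F = (relBlock P ++ genBlock P.n ++ lastBlock c).map f)
    (hF' : List.ofFn F' = (relBlock P ++ genBlock P.n ++ lastBlock c').map f)
    (h : HurwitzEquiv F F') :
    ∃ u ∈ Subgroup.normalClosure (Set.range P.relator), c' = u⁻¹ * c * u := by
  set X : FreeGroup (Fin (P.n + 1)) := FreeGroup.of (Fin.last P.n) with hX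
  have hφX : graphHom P X = 1 := by simp [graphHom, hX]
  have hcX : (c, X) ∈ graphSubgroup P := by
    rw [mem_graphSubgroup, hφX]
    exact (presentedGroup_mk_eq_one P).2 hc
  let Y : Set (FreeGroup (Fin P.n) × FreeGroup (Fin (P.n + 1))) :=
    {p | p ∈ graphSubgroup P ∧ ((∃ u ∈ graphSubgroup P, p = u⁻¹ * (c, X) * u) ∨
      Multiplicative.toAdd (lastExponent P.n p.2) ≤ 0)}
  have hYconj : ∀ x ∈ Y, ∀ u ∈ graphSubgroup P, u⁻¹ * x * u ∈ Y := by
    rintro x ⟨hx, hx'⟩ u hu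
    refine ⟨Subgroup.mul_mem _ (Subgroup.mul_mem _ (Subgroup.inv_mem _ hu) hx) hu, ?_⟩
    refine hx'.imp ?_ ?_
    · rintro ⟨v, hv, rfl⟩
      exact ⟨v * u, Subgroup.mul_mem _ hv hu, by group⟩
    · intro h
      simpa using h
  have hS0 : ∀ x ∈ graphSubgroup P ⊓ ((lastExponent P.n).comp (MonoidHom.snd _ _)).ker, x ∈ Y := by
    rintro x ⟨hx, hx'⟩
    refine ⟨hx, Or.inr ?_⟩
    have : lastExponent P.n x.2 = 1 := hx'
    simp [this]
  have hmem : ∀ x ∈ relBlock P ++ genBlock P.n ++ lastBlock c, x ∈ Y := by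
    intro x hx
    rw [List.mem_append, List.mem_append] at hx
    rcases hx with (hx | hx) | hx
    · refine hS0 x (closeUp_mem (fun j => Subgroup.mem_inf.2 ⟨?_, ?_⟩) hx)
      · change PresentedGroup.mk _ (P.relator j) = graphHom P 1
        rw [map_one]
        exact (presentedGroup_mk_eq_one P).2 (Subgroup.subset_normalClosure ⟨j, rfl⟩)
      · simp [MonoidHom.mem_ker]
    · refine hS0 x (closeUp_mem (fun j => Subgroup.mem_inf.2 ⟨?_, ?_⟩) hx)
      · change PresentedGroup.mk _ (FreeGroup.of j) = graphHom P (FreeGroup.of j.castSucc)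
        simp [graphHom, PresentedGroup.of]
      · simp [MonoidHom.mem_ker, lastExponent, Fin.castSucc_ne_last]
    · simp only [lastBlock, List.mem_cons, List.not_mem_nil, or_false] at hx
      rcases hx with rfl | rfl
      · refine ⟨Subgroup.inv_mem _ hcX, Or.inr ?_⟩
        simp [lastExponent_of_last]
      · exact ⟨hcX, Or.inl ⟨1, Subgroup.one_mem _, by simp [hX]⟩⟩
  have hFY : ∀ k, F k ∈ f '' Y := by
    intro k
    have : F k ∈ (relBlock P ++ genBlock P.n ++ lastBlock c).map f :=
      hF ▸ List.mem_ofFn.2 ⟨k, rfl⟩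
    obtain ⟨x, hx, hxk⟩ := List.mem_map.1 this
    exact ⟨x, hmem x hx, hxk⟩
  have hF'Y := h.mem_of_forall_mem (Y := f '' Y)
    (by
      rintro _ ⟨x, hx, rfl⟩ _ ⟨y, hy, rfl⟩
      exact ⟨y⁻¹ * x * y, hYconj x hx y hy.1, by simp⟩)
    (by
      rintro _ ⟨x, hx, rfl⟩ _ ⟨y, hy, rfl⟩
      exact ⟨x * y * x⁻¹, by simpa using hYconj y hy x⁻¹ (Subgroup.inv_mem _ hx.1), by simp⟩)
    hFY
  have hlast : f (c', X) ∈ List.ofFn F' := by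
    rw [hF']
    exact List.mem_map_of_mem (by simp [lastBlock, hX])
  obtain ⟨k, hk⟩ := List.mem_ofFn.1 hlast
  obtain ⟨p, hp, hpk⟩ := hF'Y k
  obtain rfl : p = (c', X) := hf (hpk.trans hk)
  obtain ⟨-, ⟨⟨u, v⟩, huv, he⟩ | hneg⟩ := hp
  · have h1 : c' = u⁻¹ * c * u := congrArg Prod.fst he
    have h2 : X = v⁻¹ * X * v := congrArg Prod.snd he
    have hcomm : Commute X v := by
      have h3 : v * X = X * v := by
        nth_rw 1 [h2]
        group
      exact h3.symm
    obtain ⟨i, rfl⟩ := Subgroup.mem_zpowers_iff.1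
      (hcomm.mem_zpowers_of_not_hasRoot (not_hasRoot_of_last P.n))
    refine ⟨u, (presentedGroup_mk_eq_one P).1 ?_, h1⟩
    rw [mem_graphSubgroup] at huv
    rw [huv, map_zpow, hφX, one_zpow]
  · simp [hX, lastExponent_of_last] at hneg

theorem eval_eq_iff (P : FinPresentation) (a b : SymWord P.n) :
    P.eval a = P.eval b ↔ (FreeGroup.mk a)⁻¹ * FreeGroup.mk b ∈
      Subgroup.normalClosure (Set.range P.relator) :=
  QuotientGroup.eq

theorem eval_eq_iff_hurwitzEquiv_ftlB (C : FTLChoice) (hP : P.InGS) (a b : SymWord P.n) :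
    P.eval a = P.eval b ↔ HurwitzEquiv (C.ftlB P hP a) (C.ftlB P hP b) := by
  set A := FreeGroup.mk a with hA
  set B := FreeGroup.mk b with hB
  constructor
  · intro h
    have h1 := hurwitzEquiv_ftlS1_conj P C (A⁻¹ * C.H P hP * A) ((eval_eq_iff P a b).1 h)
    have h2 : ((FreeGroup.mk a)⁻¹ * FreeGroup.mk b)⁻¹ * (A⁻¹ * C.H P hP * A) *
        ((FreeGroup.mk a)⁻¹ * FreeGroup.mk b) = B⁻¹ * C.H P hP * B := by
      rw [← hA, ← hB]
      group
    rwa [h2] at h1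
  · intro h
    have hAH : A⁻¹ * C.H P hP * A ∈ Subgroup.normalClosure (Set.range P.relator) := by
      simpa using Subgroup.normalClosure_normal.conj_mem _ (C.H_mem P hP) A⁻¹
    obtain ⟨u, hu, hconj⟩ := exists_conj_of_hurwitzEquiv P (C.emb_injective P.n (P.n + 1)) hAH
      (ofFn_ftlS1 P C _) (ofFn_ftlS1 P C _) h
    rw [← hB] at hconj
    have hcomm : Commute (C.H P hP) (A * u * B⁻¹) := by
      have h1 : C.H P hP = B * (u⁻¹ * (A⁻¹ * C.H P hP * A) * u) * B⁻¹ := by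
        rw [← hconj]
        group
      have h2 : A * u * B⁻¹ * C.H P hP = C.H P hP * (A * u * B⁻¹) := by
        nth_rw 1 [h1]
        group
      exact h2.symm
    have hmem : A * u * B⁻¹ ∈ Subgroup.normalClosure (Set.range P.relator) :=
      (Subgroup.zpowers_le.2 (C.H_mem P hP))
        (hcomm.mem_zpowers_of_not_hasRoot (C.H_noRoot P hP))
    have h1 := (presentedGroup_mk_eq_one P).2 hmem
    rw [map_mul, map_mul, (presentedGroup_mk_eq_one P).2 hu, map_inv, mul_one,
      mul_inv_eq_one] at h1
    exact h1

end Converse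

/-! ### Computability -/

section Computability

theorem FreeGroup.mk_flatMap_toWord {α β : Type*} [DecidableEq β]
    (f : FreeGroup α →* FreeGroup β) (w : List (α × Bool)) :
    FreeGroup.mk (w.flatMap fun x => (f (FreeGroup.mk [x])).toWord) = f (FreeGroup.mk w) := by
  induction w with
  | nil => simp [← FreeGroup.one_eq_mk]
  | cons x w ih =>
    rw [List.flatMap_cons, ← FreeGroup.mul_mk, ih, FreeGroup.mk_toWord,
      ← MonoidHom.map_mul, FreeGroup.mul_mk]
    rfl

theorem primrec_invRev (n : ℕ) : Primrec (FreeGroup.invRev : SymWord n → SymWord n) := by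
  unfold FreeGroup.invRev
  refine Primrec.list_reverse.comp (Primrec.list_map Primrec.id ?_)
  exact (Primrec.dom_finite fun g : Fin n × Bool => (g.1, !g.2)).comp Primrec.snd

/-- A homomorphism to `F₂ ⊕ F₂`, followed by multiplication with a fixed element, is computable at
the level of words: replace every letter by a fixed pair of words. -/
theorem exists_primrec_evalPair {n : ℕ} (f : FreeGroup (Fin n) →* F2F2) (y : F2F2) :
    ∃ g : SymWord n → SymWord 2 × SymWord 2, Primrec g ∧
      ∀ w, evalPair (g w) = f (FreeGroup.mk w) * y := by
  have hsub : ∀ (f : FreeGroup (Fin n) →* FreeGroup (Fin 2)) (v : SymWord 2),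
      Primrec fun w : SymWord n =>
        (w.flatMap fun x => (f (FreeGroup.mk [x])).toWord) ++ v := fun f v =>
    Primrec.list_append.comp
      (Primrec.list_flatMap Primrec.id ((Primrec.dom_finite
        fun x : Fin n × Bool => (f (FreeGroup.mk [x])).toWord).comp Primrec.snd))
      (Primrec.const v)
  refine ⟨_, (hsub ((MonoidHom.fst _ _).comp f) y.1.toWord).pair
    (hsub ((MonoidHom.snd _ _).comp f) y.2.toWord), fun w => ?_⟩
  simp only [evalPair, ← FreeGroup.mul_mk, FreeGroup.mk_flatMap_toWord, FreeGroup.mk_toWord]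
  rfl

theorem primrec_conjWord {n : ℕ} (h : SymWord n) :
    Primrec fun a : SymWord n => FreeGroup.invRev a ++ h ++ a :=
  Primrec.list_append.comp (Primrec.list_append.comp (primrec_invRev n) (Primrec.const h))
    Primrec.id

theorem exists_computable_ftlB (C : FTLChoice) (P : FinPresentation) (hP : P.InGS) :
    ∃ f : SymWord P.n → List (SymWord 2 × SymWord 2), Computable f ∧
      ∀ a : SymWord P.n, (f a).map evalPair = List.ofFn (C.ftlB P hP a) := by
  set ι := C.emb P.n (P.n + 1)
  set X : FreeGroup (Fin (P.n + 1)) := FreeGroup.of (Fin.last P.n) with hX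
  obtain ⟨g, hg, hg'⟩ := exists_primrec_evalPair (ι.comp (MonoidHom.inl _ _)) (ι (1, X))
  obtain ⟨g₁, hg₁, hg₁'⟩ := exists_primrec_evalPair (ι.comp (MonoidHom.inl _ _)) (ι (1, X⁻¹))
  have hconj : ∀ (h : FreeGroup (Fin P.n)) (a : SymWord P.n),
      FreeGroup.mk (FreeGroup.invRev a ++ h.toWord ++ a) =
        (FreeGroup.mk a)⁻¹ * h * FreeGroup.mk a := by
    intro h a
    rw [← FreeGroup.mul_mk, ← FreeGroup.mul_mk, FreeGroup.mk_toWord, FreeGroup.inv_mk]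
  -- Only the last two entries depend on the word.
  refine ⟨fun a => (((relBlock P ++ genBlock P.n).map ι).map fun x => (x.1.toWord, x.2.toWord)) ++
    [g₁ (FreeGroup.invRev a ++ (C.H P hP)⁻¹.toWord ++ a),
      g (FreeGroup.invRev a ++ (C.H P hP).toWord ++ a)], Primrec.to_comp ?_, fun a => ?_⟩
  · exact Primrec.list_append.comp (Primrec.const _) (Primrec.list_cons.comp
      (hg₁.comp (primrec_conjWord _)) (Primrec.list_cons.comp (hg.comp (primrec_conjWord _))
        (Primrec.const [])))
  · unfold FTLChoice.ftlB
    rw [ofFn_ftlS1, List.map_append, List.map_append (l₂ := lastBlock _)]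
    congr 1
    · rw [List.map_map]
      refine (List.map_congr_left fun x _ => ?_).trans (List.map_id _)
      simp [evalPair, FreeGroup.mk_toWord]
    · simp only [List.map_cons, List.map_nil, lastBlock, hg', hg₁', hconj]
      simp only [MonoidHom.comp_apply, MonoidHom.inl_apply, ← map_mul]
      simp [mul_assoc, ι, hX]

end Computability

theorem mainTheorem2 :
    Nonempty FTLChoice ∧
    ∀ (C : FTLChoice) (P : FinPresentation) (hP : P.InGS),
      (∀ a : SymWord P.n, IsFactorization 1 (C.ftlB P hP a)) ∧
      (∀ a b : SymWord P.n,
        P.eval a = P.eval b ↔ HurwitzEquiv (C.ftlB P hP a) (C.ftlB P hP b)) ∧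
      ∃ f : SymWord P.n → List (SymWord 2 × SymWord 2), Computable f ∧
        ∀ a : SymWord P.n, (f a).map evalPair = List.ofFn (C.ftlB P hP a) :=
  ⟨nonempty_FTLChoice, fun C P hP => ⟨fun _ => isFactorization_ftlS1 P C _,
    eval_eq_iff_hurwitzEquiv_ftlB P C hP, exists_computable_ftlB C P hP⟩⟩
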